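/- Let $R$ be an associative ring with identity, not necessarily commutative, that is left Noetherian or right Noetherian, and let $\delta$ be a derivation of $R$, i.e. an additive map $\delta:R\to R$ with $\delta(ab)=\delta(a)b+a\delta(b)$ for all $a,b\in R$. Let $R((x^{-1};\delta))$ be the pseudo-differential operator ring: its elements are the formal series $\sum_{i=-\infty}^{n}a_ix^i$ with $n\in\mathbb Z$ and $a_i\in R$, addition is coefficientwise, and multiplication is determined by $xa=ax+\delta(a)$ and $x^{-1}a=\sum_{k=0}^{\infty}(-1)^k\delta^k(a)x^{-k-1}$ for $a\in R$, that is, $$\Big(\sum_i a_ix^i\Big)\Big(\sum_j b_jx^j\Big)=\sum_{n}\Big(\sum_{i+j-k=n,\ k\ge 0}\binom{i}{k}a_i\,\delta^k(b_j)\Big)x^{n},\qquad \binom{i}{k}=\frac{i(i-1)\cdots(i-k+1)}{k!}.$$ A subset $S$ of a ring is called left T-nilpotent if for every sequence $s_1,s_2,\ldots$ of elements of $S$ there is an integer $k\ge 1$ with $s_1s_2\cdots s_k=0$. For a ring $A$, the left T-nilpotent radideal $\mathcal I_l(A)$ is the sum of all left T-nilpotent two-sided ideals of $A$. Put $$\mathcal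 I_{l,\delta}(R)=\Big\{a\in R:\ \text{the right ideal } \sum_{j=0}^{\infty}\delta^j(a)R\ \text{ is left T-nilpotent}\Big\},$$ and for a subset $I\subseteq R$ let $I((x^{-1};\delta))$ denote the set of all series in $R((x^{-1};\delta))$ whose coefficients all lie in $I$. Then $$\mathcal I_l\big(R((x^{-1};\delta))\big)=\mathcal I_{l,\delta}(R)((x^{-1};\delta)).$$ -/

import Mathlib

/-- A derivation of a (not necessarily commutative) ring: an additive map `δ` with
`δ (a * b) = δ a * b + a * δ b`. -/
structure RingDerivation (R : Type*) [Ring R] extends R →+ R where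
  leibniz' : ∀ a b : R, toFun (a * b) = toFun a * b + a * toFun b

namespace RingDerivation

variable {R : Type*} [Ring R]

instance : FunLike (RingDerivation R) R R where
  coe δ := δ.toFun
  coe_injective := by
    rintro ⟨⟨⟨f, _⟩, _⟩, _⟩ ⟨⟨⟨g, _⟩, _⟩, _⟩ h
    cases h
    rfl

instance : AddMonoidHomClass (RingDerivation R) R R where
  map_add δ := δ.toAddMonoidHom.map_add
  map_zero δ := δ.toAddMonoidHom.map_zero

theorem leibniz (δ : RingDerivation R) (a b : R) : δ (a * b) = δ a * b + a * δ b :=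
  δ.leibniz' a b

theorem map_one_eq_zero (δ : RingDerivation R) : δ 1 = 0 := by
  have h := δ.leibniz 1 1
  simpa using h

theorem iterate_zero_right (δ : RingDerivation R) (k : ℕ) : δ^[k] 0 = 0 :=
  iterate_map_zero δ k

theorem iterate_add_right (δ : RingDerivation R) (k : ℕ) (a b : R) :
    δ^[k] (a + b) = δ^[k] a + δ^[k] b :=
  iterate_map_add δ k a b

theorem iterate_zsmul (δ : RingDerivation R) (k : ℕ) (z : ℤ) (a : R) :
    δ^[k] (z • a) = z • δ^[k] a := by
  induction k with
  | zero => rfl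
  | succ k ih => simp only [Function.iterate_succ_apply', ih, map_zsmul]

theorem iterate_sum {ι : Type*} (δ : RingDerivation R) (k : ℕ) (s : Finset ι) (f : ι → R) :
    δ^[k] (∑ i ∈ s, f i) = ∑ i ∈ s, δ^[k] (f i) := by
  induction k with
  | zero => rfl
  | succ k ih => simp only [Function.iterate_succ_apply', ih, map_sum]

theorem iterate_one (δ : RingDerivation R) (k : ℕ) (hk : k ≠ 0) : δ^[k] 1 = 0 := by
  obtain ⟨k, rfl⟩ := Nat.exists_eq_succ_of_ne_zero hk
  rw [Function.iterate_succ_apply, map_one_eq_zero, iterate_zero_right]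

theorem iterate_mul (δ : RingDerivation R) (n : ℕ) (a b : R) :
    δ^[n] (a * b) =
      ∑ p ∈ Finset.HasAntidiagonal.antidiagonal n, n.choose p.1 • (δ^[p.1] a * δ^[p.2] b) := by
  induction n with
  | zero => simp
  | succ n ih =>
    rw [Finset.sum_antidiagonal_choose_succ_nsmul (M := R) (fun i j => δ^[i] a * δ^[j] b) n]
    simp only [Function.iterate_succ_apply', ih, map_sum, map_nsmul, leibniz, smul_add,
      Finset.sum_add_distrib]
    rw [add_comm]
    congr 1
    refine Finset.sum_congr rfl fun ⟨i, j⟩ hij ↦ ?_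
    rw [n.choose_symm_of_eq_add (Finset.HasAntidiagonal.mem_antidiagonal.1 hij).symm]

end RingDerivation

/-- The underlying set of the pseudo-differential operator ring `R((x⁻¹; δ))`: formal series
`∑_{i ≤ n} a_i x^i` (`i` running over the integers, coefficients `a_i = coeff i` on the left),
i.e. coefficient functions on `ℤ` that vanish at all sufficiently large integers. -/
@[ext]
structure PseudoDiff {R : Type*} [Ring R] (δ : RingDerivation R) where
  coeff : ℤ → R
  bdd : ∃ N : ℤ, ∀ i, N < i → coeff i = 0

namespace PseudoDiff

variable {R : Type*} [Ring R] {δ : RingDerivation R}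

theorem coeff_injective : Function.Injective (coeff : PseudoDiff δ → ℤ → R) :=
  fun _ _ h => PseudoDiff.ext h

instance : Zero (PseudoDiff δ) := ⟨⟨0, 0, fun _ _ => rfl⟩⟩

instance : Add (PseudoDiff δ) where
  add f g := ⟨f.coeff + g.coeff, by
    obtain ⟨N, hN⟩ := f.bdd
    obtain ⟨M, hM⟩ := g.bdd
    refine ⟨max N M, fun i hi => ?_⟩
    simp [hN i (lt_of_le_of_lt (le_max_left _ _) hi), hM i (lt_of_le_of_lt (le_max_right _ _) hi)]⟩

instance : Neg (PseudoDiff δ) where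
  neg f := ⟨-f.coeff, by
    obtain ⟨N, hN⟩ := f.bdd
    exact ⟨N, fun i hi => by simp [hN i hi]⟩⟩

instance : Sub (PseudoDiff δ) where
  sub f g := ⟨f.coeff - g.coeff, by
    obtain ⟨N, hN⟩ := f.bdd
    obtain ⟨M, hM⟩ := g.bdd
    refine ⟨max N M, fun i hi => ?_⟩
    simp [hN i (lt_of_le_of_lt (le_max_left _ _) hi), hM i (lt_of_le_of_lt (le_max_right _ _) hi)]⟩

instance : SMul ℕ (PseudoDiff δ) where
  smul n f := ⟨n • f.coeff, by
    obtain ⟨N, hN⟩ := f.bdd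
    exact ⟨N, fun i hi => by simp [hN i hi]⟩⟩

instance : SMul ℤ (PseudoDiff δ) where
  smul n f := ⟨n • f.coeff, by
    obtain ⟨N, hN⟩ := f.bdd
    exact ⟨N, fun i hi => by simp [hN i hi]⟩⟩

instance : AddCommGroup (PseudoDiff δ) :=
  coeff_injective.addCommGroup coeff rfl (fun _ _ => rfl) (fun _ => rfl) (fun _ _ => rfl)
    (fun _ _ => rfl) (fun _ _ => rfl)

theorem coeff_zero (n : ℤ) : (0 : PseudoDiff δ).coeff n = 0 := rfl

theorem coeff_add (f g : PseudoDiff δ) (n : ℤ) : (f + g).coeff n = f.coeff n + g.coeff n := rfl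

variable (δ) in
/-- The monomial `a x^i`. -/
def monomial (i : ℤ) (a : R) : PseudoDiff δ :=
  ⟨fun n => if n = i then a else 0, i, fun _ hn => if_neg (ne_of_gt hn)⟩

theorem coeff_monomial (i : ℤ) (a : R) (n : ℤ) :
    (monomial δ i a).coeff n = if n = i then a else 0 := rfl

instance : One (PseudoDiff δ) := ⟨monomial δ 0 1⟩

theorem coeff_one (n : ℤ) : (1 : PseudoDiff δ).coeff n = if n = 0 then 1 else 0 := rfl

theorem exists_bound (f : PseudoDiff δ) :
    ∃ N : ℕ, ∀ i : ℤ, (N : ℤ) < i → f.coeff i = 0 := by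
  obtain ⟨N, hN⟩ := f.bdd
  exact ⟨N.toNat, fun i hi => hN i (by omega)⟩

/-- The multiplication of `R((x⁻¹; δ))`. It is the one determined by `x a = a x + δ(a)` and
`x⁻¹ a = ∑_k (-1)^k δ^k(a) x^(-1-k)`, that is, by
`x^i b = ∑_{k ≥ 0} (i choose k) δ^k(b) x^(i-k)` for every integer `i`,
with `i choose k = i (i-1) ⋯ (i-k+1) / k!`. Hence the coefficient of `x^n` in
`(∑ a_i x^i) (∑ b_j x^j)` is the sum of `(i choose k) a_i δ^k(b_j)` over all `i, j, k` with
`i + j - k = n`; only finitely many of these terms are nonzero. -/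
noncomputable def mulCoeff (f g : PseudoDiff δ) (n : ℤ) : R :=
  ∑ᶠ p : ℤ × ℕ, Ring.choose p.1 p.2 • (f.coeff p.1 * δ^[p.2] (g.coeff (n - p.1 + p.2)))

variable (δ) in
/-- The coefficient of `x^n` in `(a x^i) (b x^j)`. -/
noncomputable def monoMul (n i j : ℤ) (a b : R) : R :=
  if n ≤ i + j then Ring.choose i (i + j - n).toNat • (a * δ^[(i + j - n).toNat] b) else 0

theorem monoMul_zero_left (n i j : ℤ) (b : R) : monoMul δ n i j 0 b = 0 := by
  simp [monoMul]

theorem monoMul_zero_right (n i j : ℤ) (a : R) : monoMul δ n i j a 0 = 0 := by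
  simp [monoMul]

theorem monoMul_add_left (n i j : ℤ) (a a' b : R) :
    monoMul δ n i j (a + a') b = monoMul δ n i j a b + monoMul δ n i j a' b := by
  unfold monoMul
  split_ifs <;> simp [add_mul]

theorem monoMul_add_right (n i j : ℤ) (a b b' : R) :
    monoMul δ n i j a (b + b') = monoMul δ n i j a b + monoMul δ n i j a b' := by
  unfold monoMul
  split_ifs <;> simp [mul_add]

theorem monoMul_sum_left {ι : Type*} (n i j : ℤ) (s : Finset ι) (a : ι → R) (b : R) :
    monoMul δ n i j (∑ t ∈ s, a t) b = ∑ t ∈ s, monoMul δ n i j (a t) b := by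
  unfold monoMul
  split_ifs <;> simp [Finset.sum_mul, Finset.mul_sum]

theorem monoMul_sum_right {ι : Type*} (n i j : ℤ) (s : Finset ι) (a : R) (b : ι → R) :
    monoMul δ n i j a (∑ t ∈ s, b t) = ∑ t ∈ s, monoMul δ n i j a (b t) := by
  unfold monoMul
  split_ifs <;> simp [RingDerivation.iterate_sum, Finset.mul_sum]

theorem mulCoeff_eq_sum (f g : PseudoDiff δ) (n N M : ℤ)
    (hf : ∀ i, N < i → f.coeff i = 0) (hg : ∀ i, M < i → g.coeff i = 0) (S T : Finset ℤ)
    (hS : Finset.Icc (n - M) N ⊆ S) (hT : Finset.Icc (n - N) M ⊆ T) :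
    mulCoeff f g n = ∑ i ∈ S, ∑ j ∈ T, monoMul δ n i j (f.coeff i) (g.coeff j) := by
  classical
  have key : mulCoeff f g n = ∑ p ∈ ((S ×ˢ T).filter (fun q => n ≤ q.1 + q.2)).image
      (fun q => (q.1, (q.1 + q.2 - n).toNat)),
      Ring.choose p.1 p.2 • (f.coeff p.1 * δ^[p.2] (g.coeff (n - p.1 + p.2))) := by
    refine finsum_eq_sum_of_support_subset _ ?_
    rintro ⟨i, k⟩ hik
    have h1 : i ≤ N := by
      by_contra h
      exact hik (by simp [hf i (by omega)])
    have h2 : n - i + k ≤ M := by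
      by_contra h
      exact hik (by simp [hg (n - i + k) (by omega)])
    simp only [Finset.coe_image, Set.mem_image, Finset.mem_coe, Finset.mem_filter,
      Finset.mem_product]
    refine ⟨(i, n - i + k), ⟨⟨hS ?_, hT ?_⟩, ?_⟩, ?_⟩
    · simp only [Finset.mem_Icc]; omega
    · simp only [Finset.mem_Icc]; omega
    · simp only; omega
    · simp only [Prod.mk.injEq, true_and]; omega
  rw [key, Finset.sum_image, Finset.sum_filter, Finset.sum_product]
  · refine Finset.sum_congr rfl fun i _ => Finset.sum_congr rfl fun j _ => ?_
    unfold monoMul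
    split_ifs with h
    · have : n - i + ((i + j - n).toNat : ℤ) = j := by omega
      simp only [this]
    · rfl
  · rintro ⟨i, j⟩ h1 ⟨i', j'⟩ h2 h
    simp only [Finset.coe_filter, Set.mem_ofPred_eq, Prod.mk.injEq] at h1 h2 h ⊢
    omega

noncomputable instance : Mul (PseudoDiff δ) where
  mul f g := ⟨mulCoeff f g, by
    obtain ⟨N, hN⟩ := f.bdd
    obtain ⟨M, hM⟩ := g.bdd
    refine ⟨N + M, fun n hn => ?_⟩
    rw [mulCoeff_eq_sum f g n N M hN hM _ _ subset_rfl subset_rfl, Finset.Icc_eq_empty (by omega),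
      Finset.sum_empty]⟩

theorem coeff_mul (f g : PseudoDiff δ) (n : ℤ) :
    (f * g).coeff n =
      ∑ᶠ p : ℤ × ℕ, Ring.choose p.1 p.2 • (f.coeff p.1 * δ^[p.2] (g.coeff (n - p.1 + p.2))) :=
  rfl

theorem coeff_mul_eq_sum (f g : PseudoDiff δ) (n N M : ℤ)
    (hf : ∀ i, N < i → f.coeff i = 0) (hg : ∀ i, M < i → g.coeff i = 0) (S T : Finset ℤ)
    (hS : Finset.Icc (n - M) N ⊆ S) (hT : Finset.Icc (n - N) M ⊆ T) :
    (f * g).coeff n = ∑ i ∈ S, ∑ j ∈ T, monoMul δ n i j (f.coeff i) (g.coeff j) :=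
  mulCoeff_eq_sum f g n N M hf hg S T hS hT

theorem coeff_mul_eq_zero (f g : PseudoDiff δ) (n N M : ℤ)
    (hf : ∀ i, N < i → f.coeff i = 0) (hg : ∀ i, M < i → g.coeff i = 0) (hn : N + M < n) :
    (f * g).coeff n = 0 := by
  rw [coeff_mul_eq_sum f g n N M hf hg _ _ subset_rfl subset_rfl, Finset.Icc_eq_empty (by omega),
    Finset.sum_empty]

/-- The binomial identity behind associativity. -/
theorem binom_identity (i j : ℤ) (T : ℕ) (F : ℕ → ℕ → R) :
    ∑ p ∈ Finset.HasAntidiagonal.antidiagonal T, (Ring.choose i p.1 * Ring.choose (i + j - p.1) p.2) • F p.1 p.2 =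
      ∑ p ∈ Finset.HasAntidiagonal.antidiagonal T, ∑ q ∈ Finset.HasAntidiagonal.antidiagonal p.1,
        (Ring.choose i p.1 * Ring.choose j p.2 * (p.1.choose q.1 : ℤ)) • F q.1 (q.2 + p.2) := by
  have h1 : ∀ p ∈ Finset.HasAntidiagonal.antidiagonal T,
      (Ring.choose i p.1 * Ring.choose (i + j - p.1) p.2) • F p.1 p.2 =
        ∑ q ∈ Finset.HasAntidiagonal.antidiagonal p.2,
          (Ring.choose i p.1 * (Ring.choose (i - p.1) q.1 * Ring.choose j q.2)) •
            F p.1 p.2 := by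
    rintro ⟨p, s⟩ -
    have : i + j - (p : ℤ) = (i - p) + j := by ring
    simp only
    rw [this, Ring.add_choose_eq s (Commute.all (i - (p : ℤ)) j), Finset.mul_sum, Finset.sum_smul]
  rw [Finset.sum_congr rfl h1, Finset.sum_sigma', Finset.sum_sigma']
  refine Finset.sum_nbij' (fun x => ⟨(x.1.1 + x.2.1, x.2.2), (x.1.1, x.2.1)⟩)
    (fun x => ⟨(x.2.1, x.2.2 + x.1.2), (x.2.2, x.1.2)⟩) ?_ ?_ ?_ ?_ ?_
  · rintro ⟨⟨a, b⟩, ⟨c, d⟩⟩ h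
    simp only [Finset.mem_sigma, Finset.HasAntidiagonal.mem_antidiagonal, and_true] at h ⊢
    omega
  · rintro ⟨⟨a, b⟩, ⟨c, d⟩⟩ h
    simp only [Finset.mem_sigma, Finset.HasAntidiagonal.mem_antidiagonal, and_true] at h ⊢
    omega
  · rintro ⟨⟨a, b⟩, ⟨c, d⟩⟩ h
    simp only [Finset.mem_sigma, Finset.HasAntidiagonal.mem_antidiagonal] at h
    obtain ⟨h, rfl⟩ := h
    rfl
  · rintro ⟨⟨a, b⟩, ⟨c, d⟩⟩ h
    simp only [Finset.mem_sigma, Finset.HasAntidiagonal.mem_antidiagonal] at h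
    obtain ⟨h, rfl⟩ := h
    rfl
  · rintro ⟨⟨a, b⟩, ⟨c, d⟩⟩ h
    simp only [Finset.mem_sigma, Finset.HasAntidiagonal.mem_antidiagonal] at h
    obtain ⟨h, rfl⟩ := h
    have hc := Ring.choose_smul_choose i (n := a + c) (k := a) (Nat.le_add_right _ _)
    rw [Nat.add_sub_cancel_left, nsmul_eq_mul] at hc
    simp only
    congr 1
    linear_combination (-Ring.choose j d) * hc

theorem monoMul_assoc (n i j l : ℤ) (a b c : R) (C : Finset ℤ)
    (h1 : Finset.Icc (n - l) (i + j) ⊆ C) (h2 : Finset.Icc (n - i) (j + l) ⊆ C) :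
    ∑ s ∈ C, monoMul δ n s l (monoMul δ s i j a b) c =
      ∑ s ∈ C, monoMul δ n i s a (monoMul δ s j l b c) := by
  classical
  have e1 : ∑ s ∈ C, monoMul δ n s l (monoMul δ s i j a b) c =
      ∑ s ∈ Finset.Icc (n - l) (i + j), monoMul δ n s l (monoMul δ s i j a b) c := by
    refine (Finset.sum_subset h1 fun s _ hs => ?_).symm
    rw [Finset.mem_Icc, not_and_or] at hs
    unfold monoMul
    rcases hs with hs | hs
    · rw [if_neg (by omega)]
    · rw [if_neg (c := s ≤ i + j) (by omega)]; simp
  have e2 : ∑ s ∈ C, monoMul δ n i s a (monoMul δ s j l b c) =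
      ∑ s ∈ Finset.Icc (n - i) (j + l), monoMul δ n i s a (monoMul δ s j l b c) := by
    refine (Finset.sum_subset h2 fun s _ hs => ?_).symm
    rw [Finset.mem_Icc, not_and_or] at hs
    unfold monoMul
    rcases hs with hs | hs
    · rw [if_neg (by omega)]
    · rw [if_neg (c := s ≤ j + l) (by omega)]
      simp
  rw [e1, e2]
  by_cases hn : n ≤ i + j + l
  swap
  · rw [Finset.Icc_eq_empty (by omega), Finset.Icc_eq_empty (by omega)]; simp
  obtain ⟨T, hT⟩ := Int.eq_ofNat_of_zero_le (show 0 ≤ i + j + l - n by omega)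
  have e3 : ∑ s ∈ Finset.Icc (n - l) (i + j), monoMul δ n s l (monoMul δ s i j a b) c =
      ∑ p ∈ Finset.HasAntidiagonal.antidiagonal T, (Ring.choose i p.1 * Ring.choose (i + j - p.1) p.2) •
        (a * δ^[p.1] b * δ^[p.2] c) := by
    refine Finset.sum_nbij' (fun s => ((i + j - s).toNat, (s + l - n).toNat))
      (fun p => i + j - p.1) ?_ ?_ ?_ ?_ ?_
    · intro s hs
      simp only [Finset.mem_Icc, Finset.HasAntidiagonal.mem_antidiagonal] at hs ⊢
      omega
    · rintro ⟨p, q⟩ hs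
      simp only [Finset.mem_Icc, Finset.HasAntidiagonal.mem_antidiagonal] at hs ⊢
      omega
    · intro s hs
      simp only [Finset.mem_Icc] at hs ⊢
      omega
    · rintro ⟨p, q⟩ hs
      simp only [Finset.HasAntidiagonal.mem_antidiagonal, Prod.mk.injEq] at hs ⊢
      omega
    · intro s hs
      simp only [Finset.mem_Icc] at hs
      unfold monoMul
      rw [if_pos (by omega), if_pos (by omega)]
      have : i + j - ((i + j - s).toNat : ℤ) = s := by omega
      simp only [this]
      rw [smul_mul_assoc, smul_smul, mul_comm]
  have e4 : ∑ s ∈ Finset.Icc (n - i) (j + l), monoMul δ n i s a (monoMul δ s j l b c) =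
      ∑ p ∈ Finset.HasAntidiagonal.antidiagonal T, (Ring.choose i p.1 * Ring.choose j p.2) •
        (a * δ^[p.1] (b * δ^[p.2] c)) := by
    refine Finset.sum_nbij' (fun s => ((i + s - n).toNat, (j + l - s).toNat))
      (fun p => j + l - p.2) ?_ ?_ ?_ ?_ ?_
    · intro s hs
      simp only [Finset.mem_Icc, Finset.HasAntidiagonal.mem_antidiagonal] at hs ⊢
      omega
    · rintro ⟨p, q⟩ hs
      simp only [Finset.mem_Icc, Finset.HasAntidiagonal.mem_antidiagonal] at hs ⊢
      omega
    · intro s hs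
      simp only [Finset.mem_Icc] at hs ⊢
      omega
    · rintro ⟨p, q⟩ hs
      simp only [Finset.HasAntidiagonal.mem_antidiagonal, Prod.mk.injEq] at hs ⊢
      omega
    · intro s hs
      simp only [Finset.mem_Icc] at hs
      unfold monoMul
      rw [if_pos (by omega), if_pos (by omega)]
      simp only
      rw [RingDerivation.iterate_zsmul, mul_smul_comm, smul_smul]
  rw [e3, e4, binom_identity i j T (fun p q => a * δ^[p] b * δ^[q] c)]
  refine Finset.sum_congr rfl fun p _ => ?_
  rw [RingDerivation.iterate_mul, Finset.mul_sum, Finset.smul_sum]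
  refine Finset.sum_congr rfl fun q _ => ?_
  rw [← Function.iterate_add_apply, mul_smul_comm, ← natCast_zsmul, smul_smul, mul_assoc a]

protected theorem mul_assoc' (f g h : PseudoDiff δ) : f * g * h = f * (g * h) := by
  ext n
  obtain ⟨N, hN⟩ := f.exists_bound
  obtain ⟨M, hM⟩ := g.exists_bound
  obtain ⟨L, hL⟩ := h.exists_bound
  have hfg : ∀ i : ℤ, (N : ℤ) + M < i → (f * g).coeff i = 0 :=
    fun i hi => coeff_mul_eq_zero f g i N M hN hM hi
  have hgh : ∀ i : ℤ, (M : ℤ) + L < i → (g * h).coeff i = 0 :=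
    fun i hi => coeff_mul_eq_zero g h i M L hM hL hi
  obtain ⟨B, hB⟩ : ∃ B : ℤ, B = N + M + L + |n| := ⟨_, rfl⟩
  have hn1 := le_abs_self n
  have hn2 := neg_abs_le n
  have hsub : ∀ u v u' v' : ℤ, u' ≤ u → v ≤ v' → Finset.Icc u v ⊆ Finset.Icc u' v' :=
    fun u v u' v' h1 h2 => Finset.Icc_subset_Icc h1 h2
  obtain ⟨D, hD⟩ : ∃ D : ℤ, D = 2 * B := ⟨_, rfl⟩
  rw [coeff_mul_eq_sum (f * g) h n (N + M) L hfg hL (Finset.Icc (-B) B) (Finset.Icc (-D) L)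
      (hsub _ _ _ _ (by omega) (by omega)) (hsub _ _ _ _ (by omega) (by omega)),
    coeff_mul_eq_sum f (g * h) n N (M + L) hN hgh (Finset.Icc (-D) N) (Finset.Icc (-B) B)
      (hsub _ _ _ _ (by omega) (by omega)) (hsub _ _ _ _ (by omega) (by omega))]
  have e1 : ∀ s ∈ Finset.Icc (-B) B, (f * g).coeff s =
      ∑ i ∈ Finset.Icc (-D) (N : ℤ), ∑ j ∈ Finset.Icc (-D) (M : ℤ),
        monoMul δ s i j (f.coeff i) (g.coeff j) := by
    intro s hs
    rw [Finset.mem_Icc] at hs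
    exact coeff_mul_eq_sum f g s N M hN hM _ _ (hsub _ _ _ _ (by omega) (by omega))
      (hsub _ _ _ _ (by omega) (by omega))
  have e2 : ∀ s ∈ Finset.Icc (-B) B, (g * h).coeff s =
      ∑ j ∈ Finset.Icc (-D) (M : ℤ), ∑ l ∈ Finset.Icc (-D) (L : ℤ),
        monoMul δ s j l (g.coeff j) (h.coeff l) := by
    intro s hs
    rw [Finset.mem_Icc] at hs
    exact coeff_mul_eq_sum g h s M L hM hL _ _ (hsub _ _ _ _ (by omega) (by omega))
      (hsub _ _ _ _ (by omega) (by omega))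
  have l1 : ∑ s ∈ Finset.Icc (-B) B, ∑ l ∈ Finset.Icc (-D) (L : ℤ),
      monoMul δ n s l ((f * g).coeff s) (h.coeff l) =
      ∑ i ∈ Finset.Icc (-D) (N : ℤ), ∑ j ∈ Finset.Icc (-D) (M : ℤ),
        ∑ l ∈ Finset.Icc (-D) (L : ℤ), ∑ s ∈ Finset.Icc (-B) B,
          monoMul δ n s l (monoMul δ s i j (f.coeff i) (g.coeff j)) (h.coeff l) := by
    rw [Finset.sum_comm]
    have e3 : ∀ l ∈ Finset.Icc (-D) (L : ℤ), ∑ s ∈ Finset.Icc (-B) B,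
        monoMul δ n s l ((f * g).coeff s) (h.coeff l) =
        ∑ i ∈ Finset.Icc (-D) (N : ℤ), ∑ j ∈ Finset.Icc (-D) (M : ℤ), ∑ s ∈ Finset.Icc (-B) B,
          monoMul δ n s l (monoMul δ s i j (f.coeff i) (g.coeff j)) (h.coeff l) := by
      intro l _
      have e4 : ∀ s ∈ Finset.Icc (-B) B, monoMul δ n s l ((f * g).coeff s) (h.coeff l) =
          ∑ i ∈ Finset.Icc (-D) (N : ℤ), ∑ j ∈ Finset.Icc (-D) (M : ℤ),
            monoMul δ n s l (monoMul δ s i j (f.coeff i) (g.coeff j)) (h.coeff l) := by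
        intro s hs
        simp only [e1 s hs, monoMul_sum_left]
      rw [Finset.sum_congr rfl e4, Finset.sum_comm]
      exact Finset.sum_congr rfl fun i _ => Finset.sum_comm
    rw [Finset.sum_congr rfl e3, Finset.sum_comm]
    exact Finset.sum_congr rfl fun i _ => Finset.sum_comm
  have l2 : ∑ i ∈ Finset.Icc (-D) (N : ℤ), ∑ s ∈ Finset.Icc (-B) B,
      monoMul δ n i s (f.coeff i) ((g * h).coeff s) =
      ∑ i ∈ Finset.Icc (-D) (N : ℤ), ∑ j ∈ Finset.Icc (-D) (M : ℤ),
        ∑ l ∈ Finset.Icc (-D) (L : ℤ), ∑ s ∈ Finset.Icc (-B) B,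
          monoMul δ n i s (f.coeff i) (monoMul δ s j l (g.coeff j) (h.coeff l)) := by
    refine Finset.sum_congr rfl fun i _ => ?_
    have e4 : ∀ s ∈ Finset.Icc (-B) B, monoMul δ n i s (f.coeff i) ((g * h).coeff s) =
        ∑ j ∈ Finset.Icc (-D) (M : ℤ), ∑ l ∈ Finset.Icc (-D) (L : ℤ),
          monoMul δ n i s (f.coeff i) (monoMul δ s j l (g.coeff j) (h.coeff l)) := by
      intro s hs
      simp only [e2 s hs, monoMul_sum_right]
    rw [Finset.sum_congr rfl e4, Finset.sum_comm]
    exact Finset.sum_congr rfl fun j _ => Finset.sum_comm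
  rw [l1, l2]
  refine Finset.sum_congr rfl fun i hi => Finset.sum_congr rfl fun j hj =>
    Finset.sum_congr rfl fun l hl => ?_
  rw [Finset.mem_Icc] at hi hj hl
  exact monoMul_assoc n i j l _ _ _ _ (hsub _ _ _ _ (by omega) (by omega))
    (hsub _ _ _ _ (by omega) (by omega))

protected theorem left_distrib' (f g h : PseudoDiff δ) : f * (g + h) = f * g + f * h := by
  ext n
  obtain ⟨N, hN⟩ := f.exists_bound
  obtain ⟨M, hM⟩ := g.exists_bound
  obtain ⟨L, hL⟩ := h.exists_bound
  have hM' : ∀ i : ℤ, (M : ℤ) + L < i → g.coeff i = 0 := fun i hi => hM i (by omega)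
  have hL' : ∀ i : ℤ, (M : ℤ) + L < i → h.coeff i = 0 := fun i hi => hL i (by omega)
  have hs : ∀ i : ℤ, (M : ℤ) + L < i → (g + h).coeff i = 0 := fun i hi => by
    rw [coeff_add, hM' i hi, hL' i hi, add_zero]
  rw [coeff_add, coeff_mul_eq_sum f (g + h) n _ _ hN hs _ _ subset_rfl subset_rfl,
    coeff_mul_eq_sum f g n _ _ hN hM' _ _ subset_rfl subset_rfl,
    coeff_mul_eq_sum f h n _ _ hN hL' _ _ subset_rfl subset_rfl]
  simp only [coeff_add, monoMul_add_right, Finset.sum_add_distrib]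

protected theorem right_distrib' (f g h : PseudoDiff δ) : (f + g) * h = f * h + g * h := by
  ext n
  obtain ⟨N, hN⟩ := f.exists_bound
  obtain ⟨M, hM⟩ := g.exists_bound
  obtain ⟨L, hL⟩ := h.exists_bound
  have hN' : ∀ i : ℤ, (N : ℤ) + M < i → f.coeff i = 0 := fun i hi => hN i (by omega)
  have hM' : ∀ i : ℤ, (N : ℤ) + M < i → g.coeff i = 0 := fun i hi => hM i (by omega)
  have hs : ∀ i : ℤ, (N : ℤ) + M < i → (f + g).coeff i = 0 := fun i hi => by
    rw [coeff_add, hN' i hi, hM' i hi, add_zero]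
  rw [coeff_add, coeff_mul_eq_sum (f + g) h n _ _ hs hL _ _ subset_rfl subset_rfl,
    coeff_mul_eq_sum f h n _ _ hN' hL _ _ subset_rfl subset_rfl,
    coeff_mul_eq_sum g h n _ _ hM' hL _ _ subset_rfl subset_rfl]
  simp only [coeff_add, monoMul_add_left, Finset.sum_add_distrib]

protected theorem one_mul' (f : PseudoDiff δ) : 1 * f = f := by
  ext n
  rw [coeff_mul, finsum_eq_single _ ((0 : ℤ), 0)]
  · simp [coeff_one]
  · rintro ⟨i, k⟩ h
    by_cases hi : i = 0
    · subst hi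
      have hk : 0 < k := Nat.pos_of_ne_zero fun hk => h (by rw [hk])
      simp [Ring.choose_zero_pos ℤ hk]
    · simp [coeff_one, hi]

protected theorem mul_one' (f : PseudoDiff δ) : f * 1 = f := by
  ext n
  rw [coeff_mul, finsum_eq_single _ (n, 0)]
  · simp [coeff_one]
  · rintro ⟨i, k⟩ h
    rw [coeff_one]
    by_cases hk : k = 0
    · subst hk
      have hi : n - i ≠ 0 := fun hi => h (by rw [show i = n by omega])
      simp [hi]
    · split_ifs <;> simp [RingDerivation.iterate_one, hk]

protected theorem zero_mul' (f : PseudoDiff δ) : 0 * f = 0 := by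
  have h := PseudoDiff.right_distrib' 0 0 f
  rw [add_zero] at h
  exact left_eq_add.mp h

protected theorem mul_zero' (f : PseudoDiff δ) : f * 0 = 0 := by
  have h := PseudoDiff.left_distrib' f 0 0
  rw [add_zero] at h
  exact left_eq_add.mp h

/-- The pseudo-differential operator ring `R((x⁻¹; δ))`. -/
noncomputable instance : Ring (PseudoDiff δ) :=
  { (inferInstance : AddCommGroup (PseudoDiff δ)) with
    mul := (· * ·)
    one := 1
    mul_assoc := PseudoDiff.mul_assoc'
    one_mul := PseudoDiff.one_mul'
    mul_one := PseudoDiff.mul_one'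
    left_distrib := PseudoDiff.left_distrib'
    right_distrib := PseudoDiff.right_distrib'
    zero_mul := PseudoDiff.zero_mul'
    mul_zero := PseudoDiff.mul_zero' }

/-- `I((x⁻¹; δ))`: the series all of whose coefficients lie in `I`. -/
def coeffsIn (δ : RingDerivation R) (I : Set R) : Set (PseudoDiff δ) :=
  {f | ∀ i : ℤ, f.coeff i ∈ I}

end PseudoDiff

/-- A subset `S` of a ring is left T-nilpotent if every sequence `s₁, s₂, …` in `S` has an
initial product `s₁ s₂ ⋯ s_k = 0` with `k ≥ 1`. -/
def IsLeftTNilpotent {R : Type*} [Ring R] (S : Set R) : Prop :=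
  ∀ s : ℕ → R, (∀ i, s i ∈ S) → ∃ k : ℕ, 1 ≤ k ∧ ((List.range k).map s).prod = 0

/-- The left T-nilpotent radideal `𝓘_l(R)`: the sum of all left T-nilpotent (two-sided) ideals,
i.e. their supremum in the lattice of two-sided ideals. -/
def leftTNilpotentRadideal (R : Type*) [Ring R] : TwoSidedIdeal R :=
  sSup {I : TwoSidedIdeal R | IsLeftTNilpotent (I : Set R)}

/-- `𝓘_{l,δ}(R)`: the set of all `a` for which the right ideal `∑_{j ≥ 0} δ^j(a) R` is left
T-nilpotent. Right ideals of `R` are the submodules of `R` over `Rᵐᵒᵖ`. -/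
def leftTNilpotentDeltaSet {R : Type*} [Ring R] (δ : RingDerivation R) : Set R :=
  {a | IsLeftTNilpotent
    ((⨆ j : ℕ, Submodule.span Rᵐᵒᵖ {δ^[j] a} : Submodule Rᵐᵒᵖ R) : Set R)}

/-! By Levitzki's theorem a one-sided Noetherian ring has a nilpotent two-sided ideal `N` containing
every `a` with `aR` nil (`exists_nilpotent_twoSidedIdeal`). Let `P` be the largest `δ`-stable ideal
inside `N`. Then `𝓘_{l,δ}(R) = P` (`leftTNilpotentDeltaSet_eq`), because left T-nilpotent sets are
nil and subsets of a nilpotent ideal are left T-nilpotent.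

One inclusion: `δ`-stability makes `P((x⁻¹; δ))` a two-sided ideal, and it is nilpotent because
products of `m` of its elements have coefficients in `P ^ m`.

The other: let `I` be a left T-nilpotent, hence nil, ideal of series. Modulo `P`, the constant terms
of elements of `I` of degree at most `0` are nilpotent. They are closed under right multiplication
by `R` and, through the commutator with `x`, under `δ`. So if `a` is one of them, every `δ^j(a)R` is
nil and `a ∈ P`. Descending through the degrees, with shifts by powers of `x`, puts all coefficients
of `I` in `P` (`coeff_mem_of_isTop`). -/

/-! ### Nilpotent ideals and T-nilpotency -/

namespace TwoSidedIdeal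

variable {R : Type*} [Ring R]

/-- A two-sided ideal regarded as a `ℤ`-submodule, so that its powers are available. -/
abbrev toIntSubmodule (N : TwoSidedIdeal R) : Submodule ℤ R :=
  N.asIdeal.restrictScalars ℤ

theorem mem_toIntSubmodule {N : TwoSidedIdeal R} {x : R} : x ∈ N.toIntSubmodule ↔ x ∈ N := by
  simp [toIntSubmodule]

theorem list_prod_mem_pow (N : TwoSidedIdeal R) (l : List R) (hl : ∀ x ∈ l, x ∈ N) :
    l.prod ∈ N.toIntSubmodule ^ l.length := by
  induction l with
  | nil => simp [Submodule.one_le.mp le_rfl]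
  | cons a l ih =>
    rw [List.prod_cons, List.length_cons, pow_succ']
    exact Submodule.mul_mem_mul (mem_toIntSubmodule.mpr (hl a (by simp)))
      (ih fun x hx => hl x (by simp [hx]))

theorem toIntSubmodule_pow_eq_bot (N : TwoSidedIdeal R) (m : ℕ)
    (h : ∀ l : List R, (∀ x ∈ l, x ∈ N) → l.length = m → l.prod = 0) :
    N.toIntSubmodule ^ m = ⊥ := by
  rw [Submodule.pow_eq_span_pow_set, Submodule.span_eq_bot]
  intro x hx
  obtain ⟨f, rfl⟩ := Set.mem_pow.mp hx
  refine h _ ?_ (by simp)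
  intro y hy
  obtain ⟨i, rfl⟩ := (List.mem_ofFn' _ _).mp hy
  exact mem_toIntSubmodule.mp (f i).2

theorem isLeftTNilpotent_of_pow_eq_bot (N : TwoSidedIdeal R) (m : ℕ)
    (h : N.toIntSubmodule ^ m = ⊥) : IsLeftTNilpotent (N : Set R) := by
  intro s hs
  -- T-nilpotency asks for a nonempty product, while `m` may be `0`; hence `m + 1`.
  refine ⟨m + 1, by omega, ?_⟩
  have := N.list_prod_mem_pow ((List.range (m + 1)).map s) (by
    intro x hx
    obtain ⟨i, -, rfl⟩ := List.mem_map.mp hx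
    exact hs i)
  simpa [pow_succ, h] using this

end TwoSidedIdeal

/-- Take a constant sequence. Apart from passing to subsets, this is all that is ever used of
T-nilpotency. -/
theorem IsLeftTNilpotent.isNilpotent {R : Type*} [Ring R] {S : Set R} (hS : IsLeftTNilpotent S)
    {a : R} (ha : a ∈ S) : IsNilpotent a := by
  obtain ⟨k, -, hk⟩ := hS (fun _ => a) fun _ => ha
  exact ⟨k, by simpa using hk⟩

theorem IsLeftTNilpotent.mono {R : Type*} [Ring R] {S T : Set R} (hT : IsLeftTNilpotent T)
    (h : S ⊆ T) : IsLeftTNilpotent S :=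
  fun s hs => hT s fun i => h (hs i)

/-! ### Levitzki's theorem -/

/-- If `a t a ∈ N` for all `t`, then the ideal generated by `N` and `a` has square inside `N`. -/
theorem Ideal.exists_isTwoSided_sq_le {R : Type*} [Ring R] (N : Ideal R) [N.IsTwoSided] (a : R)
    (ha : ∀ t, a * t * a ∈ N) :
    ∃ K : Ideal R, K.IsTwoSided ∧ N ≤ K ∧ a ∈ K ∧ ∀ x ∈ K, ∀ y ∈ K, x * y ∈ N := by
  -- The hypothesis is spread to the whole ideal one factor at a time, first on the right and then
  -- on the left. The free `t` in the middle absorbs the inner multipliers.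
  have hJ : ∀ x ∈ TwoSidedIdeal.span {a}, ∀ t, a * t * x ∈ N := by
    intro x hx
    refine TwoSidedIdeal.span_induction (p := fun x _ => ∀ t, a * t * x ∈ N) ?_ ?_ ?_ ?_ ?_ ?_ hx
    · rintro x rfl t; exact ha t
    · intro t; simp
    · intro x y _ _ hx hy t; rw [mul_add]; exact N.add_mem (hx t) (hy t)
    · intro x _ hx t; rw [mul_neg]; exact N.neg_mem (hx t)
    · intro r x _ hx t; rw [← mul_assoc, mul_assoc a]; exact hx _
    · intro r x _ hx t; rw [← mul_assoc]; exact N.mul_mem_right _ (hx t)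
  have hJJ : ∀ x ∈ TwoSidedIdeal.span {a}, ∀ y ∈ TwoSidedIdeal.span {a}, ∀ t, x * t * y ∈ N := by
    intro x hx y hy
    refine TwoSidedIdeal.span_induction (p := fun x _ => ∀ t, x * t * y ∈ N) ?_ ?_ ?_ ?_ ?_ ?_ hx
    · rintro x rfl t; exact hJ y hy t
    · intro t; simp
    · intro x y _ _ hx hy t; rw [add_mul, add_mul]; exact N.add_mem (hx t) (hy t)
    · intro x _ hx t; rw [neg_mul, neg_mul]; exact N.neg_mem (hx t)
    · intro r x _ hx t; rw [mul_assoc, mul_assoc, ← mul_assoc x]; exact N.mul_mem_left _ (hx t)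
    · intro r x _ hx t; rw [mul_assoc x]; exact hx _
  refine ⟨(N.toTwoSided ⊔ TwoSidedIdeal.span {a}).asIdeal, inferInstance, ?_, ?_, ?_⟩
  · intro x hx
    exact TwoSidedIdeal.mem_asIdeal.mpr
      ((le_sup_left : N.toTwoSided ≤ _) (Ideal.mem_toTwoSided.mpr hx))
  · exact TwoSidedIdeal.mem_asIdeal.mpr
      ((le_sup_right : TwoSidedIdeal.span {a} ≤ _) (TwoSidedIdeal.subset_span rfl))
  · have hsup : ∀ x ∈ (N.toTwoSided ⊔ TwoSidedIdeal.span {a}).asIdeal,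
        ∃ n ∈ N, ∃ j ∈ TwoSidedIdeal.span {a}, n + j = x := by
      intro x hx
      obtain ⟨n, hn, j, hj, h⟩ := TwoSidedIdeal.mem_sup.mp (TwoSidedIdeal.mem_asIdeal.mp hx)
      exact ⟨n, Ideal.mem_toTwoSided.mp hn, j, hj, h⟩
    intro x hx y hy
    obtain ⟨n, hn, j, hj, rfl⟩ := hsup x hx
    obtain ⟨n', hn', j', hj', rfl⟩ := hsup y hy
    rw [add_mul, mul_add j]
    refine N.add_mem (N.mul_mem_right _ hn) (N.add_mem (N.mul_mem_left _ hn') ?_)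
    simpa using hJJ j hj j' hj' 1

/-- **Levitzki's theorem** for left Noetherian rings. -/
theorem IsNoetherianRing.exists_nilpotent_twoSidedIdeal {R : Type*} [Ring R] [IsNoetherianRing R] :
    ∃ N : TwoSidedIdeal R, (∃ m, N.toIntSubmodule ^ m = ⊥) ∧
      ∀ a, (∀ r, IsNilpotent (a * r)) → a ∈ N := by
  -- `N` is a maximal nilpotent two-sided ideal; a counterexample to its absorbing property will
  -- produce a larger one.
  obtain ⟨N, ⟨hN2, m, hm⟩, hmax⟩ := set_has_maximal_iff_noetherian.mpr ‹IsNoetherianRing R›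
    {I : Ideal R | I.IsTwoSided ∧ ∃ m, I.restrictScalars ℤ ^ m = ⊥}
    ⟨⊥, inferInstance, 1, by simp⟩
  have := hN2
  refine ⟨Ideal.toTwoSided N, ⟨m, by simpa [TwoSidedIdeal.toIntSubmodule] using hm⟩, fun a₀ ha₀ => ?_⟩
  rw [Ideal.mem_toTwoSided]
  by_contra ha₀N
  let ann : R → Ideal R := fun a => N.comap (LinearMap.toSpanSingleton R R a)
  have mem_ann : ∀ a y, y ∈ ann a ↔ y * a ∈ N := fun a y => Iff.rfl
  -- Among all counterexamples, `a` has the largest left annihilator modulo `N`.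
  obtain ⟨_, ⟨a, haN, ha, rfl⟩, hamax⟩ := set_has_maximal_iff_noetherian.mpr ‹IsNoetherianRing R›
    {I : Ideal R | ∃ a, a ∉ N ∧ (∀ r, IsNilpotent (a * r)) ∧ ann a = I}
    ⟨_, a₀, ha₀N, ha₀, rfl⟩
  have key : ∀ t, a * t * a ∈ N := by
    intro t
    classical
    have hex : ∃ k, (a * t) ^ k * a ∈ N := by
      obtain ⟨k, hk⟩ := ha t
      exact ⟨k, by simp [hk]⟩
    -- The least exponent is positive because `a ∉ N`. Its predecessor `k` gives `b = (at)^k a`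
    -- outside `N` with `atb ∈ N`.
    obtain ⟨k, hk⟩ : ∃ k, k + 1 = Nat.find hex := by
      have h0 : Nat.find hex ≠ 0 := by
        intro h
        have := Nat.find_spec hex
        rw [h] at this
        exact haN (by simpa using this)
      exact Nat.exists_eq_succ_of_ne_zero h0 |>.imp fun _ h => h.symm
    have hk1 : (a * t) ^ k * a ∉ N := Nat.find_min hex (by omega)
    have hk2 : (a * t) ^ (k + 1) * a ∈ N := hk ▸ Nat.find_spec hex
    -- Since `b` lies in `aR`, it is again a counterexample, with `ann a ≤ ann b`. Maximality gives
    -- equality, so `at`, which lies in `ann b`, lies in `ann a`.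
    have hb : (a * t) ^ k * a = a * (t * a) ^ k := mul_pow_mul a t k
    have hle : ann a ≤ ann ((a * t) ^ k * a) := by
      intro y hy
      rw [mem_ann] at hy ⊢
      rw [hb, ← mul_assoc]
      exact Ideal.mul_mem_right _ N hy
    have hmem : ann ((a * t) ^ k * a) ∈
        {I : Ideal R | ∃ a, a ∉ N ∧ (∀ r, IsNilpotent (a * r)) ∧ ann a = I} := by
      refine ⟨_, hk1, fun r => ?_, rfl⟩
      rw [hb, mul_assoc]
      exact ha _
    have heq : ann a = ann ((a * t) ^ k * a) :=
      hle.eq_of_not_lt (hamax _ hmem)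
    rw [← mem_ann, heq, mem_ann, ← mul_assoc, ← pow_succ']
    exact hk2
  obtain ⟨K, hK2, hNK, haK, hKK⟩ := Ideal.exists_isTwoSided_sq_le N a key
  -- `K ^ 2 ≤ N` and `N ^ m = 0` give `K ^ (2 * m) = 0`.
  refine hmax K ⟨hK2, 2 * m, ?_⟩ (lt_of_le_of_ne hNK fun h => haN (h ▸ haK))
  rw [pow_mul, eq_bot_iff, ← hm]
  refine pow_le_pow_left' ?_ m
  rw [pow_two, Submodule.mul_le]
  exact hKK

/-- **Levitzki's theorem** for rings that are left or right Noetherian: there is a nilpotent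
two-sided ideal containing every element that generates a nil right ideal. -/
theorem exists_nilpotent_twoSidedIdeal {R : Type*} [Ring R]
    (hR : IsNoetherianRing R ∨ IsNoetherian Rᵐᵒᵖ R) :
    ∃ N : TwoSidedIdeal R, (∃ m, N.toIntSubmodule ^ m = ⊥) ∧
      ∀ a, (∀ r, IsNilpotent (a * r)) → a ∈ N := by
  rcases hR with hR | hR
  · exact IsNoetherianRing.exists_nilpotent_twoSidedIdeal
  · let e : R ≃ₗ[Rᵐᵒᵖ] Rᵐᵒᵖ :=
      { MulOpposite.opAddEquiv with map_smul' := fun r x => rfl }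
    have : IsNoetherianRing Rᵐᵒᵖ := isNoetherian_of_linearEquiv e
    obtain ⟨N, ⟨m, hm⟩, hN⟩ :=
      IsNoetherianRing.exists_nilpotent_twoSidedIdeal (R := Rᵐᵒᵖ)
    refine ⟨N.unop, ⟨m, ?_⟩, fun a ha => ?_⟩
    · refine TwoSidedIdeal.toIntSubmodule_pow_eq_bot _ m fun l hl hlen => ?_
      -- The list is reversed because `op` reverses products.
      have h := N.list_prod_mem_pow (l.map MulOpposite.op).reverse (by simpa using hl)
      rw [List.length_reverse, List.length_map, hlen, hm, Submodule.mem_bot,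
        ← MulOpposite.op_list_prod] at h
      simpa using h
    · rw [TwoSidedIdeal.mem_unop_iff]
      refine hN _ fun r => ?_
      obtain ⟨k, hk⟩ := ha r.unop
      -- In the opposite ring the requirement is that `Ra` be nil. It follows from `aR` nil by
      -- `(ra)^(k+1) = r (ar)^k a`.
      refine ⟨k + 1, MulOpposite.unop_injective ?_⟩
      rw [MulOpposite.unop_pow, MulOpposite.unop_mul, MulOpposite.unop_op, pow_succ, ← mul_assoc,
        mul_pow_mul, hk, mul_zero, zero_mul, MulOpposite.unop_zero]

/-! ### Series with coefficients in a `δ`-stable ideal -/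

namespace PseudoDiff

variable {R : Type*} [Ring R] {δ : RingDerivation R}

theorem coeff_sub (f g : PseudoDiff δ) (n : ℤ) : (f - g).coeff n = f.coeff n - g.coeff n := rfl

/-- If the coefficients of `f` lie in `P` and those of `g` in a `δ`-stable `Q`, then those of
`f * g` lie in `P * Q`. -/
theorem coeff_mul_mem (P Q : Submodule ℤ R) (hQ : ∀ a ∈ Q, δ a ∈ Q) (f g : PseudoDiff δ)
    (hf : ∀ i, f.coeff i ∈ P) (hg : ∀ i, g.coeff i ∈ Q) (n : ℤ) : (f * g).coeff n ∈ P * Q := by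
  have hQ' : ∀ k : ℕ, ∀ a ∈ Q, δ^[k] a ∈ Q := fun k => by
    induction k with
    | zero => exact fun a ha => ha
    | succ k ih => exact fun a ha => ih _ (hQ a ha)
  rw [coeff_mul]
  exact finsum_induction (· ∈ P * Q) (zero_mem _) (fun _ _ => add_mem) fun p => Submodule.smul_mem _ _
    (Submodule.mul_mem_mul (hf _) (hQ' _ _ (hg _)))

/-- The Leibniz rule keeps the number of factors from `P`. The zeroth power is the image of `ℤ`,
which `δ` kills. -/
theorem map_mem_pow (P : Submodule ℤ R) (hP : ∀ a ∈ P, δ a ∈ P) (k : ℕ) :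
    ∀ a ∈ P ^ k, δ a ∈ P ^ k := by
  induction k with
  | zero =>
    intro a ha
    rw [pow_zero, Submodule.mem_one] at ha
    obtain ⟨z, rfl⟩ := ha
    have : δ (algebraMap ℤ R z) = 0 := by
      rw [algebraMap_int_eq, eq_intCast, ← zsmul_one, map_zsmul, δ.map_one_eq_zero, smul_zero]
    rw [this]
    exact zero_mem _
  | succ k ih =>
    intro a ha
    rw [pow_succ] at ha ⊢
    induction ha using Submodule.mul_induction_on' with
    | mem_mul_mem x hx y hy =>
      rw [δ.leibniz]
      exact add_mem (Submodule.mul_mem_mul (ih x hx) hy) (Submodule.mul_mem_mul hx (hP y hy))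
    | add x hx y hy h1 h2 =>
      rw [map_add]
      exact add_mem h1 h2

/-- Multiplying series differentiates the coefficients of the right factor, so the induction needs
the powers of `P` to be `δ`-stable as well. -/
theorem coeff_list_prod_mem_pow (P : Submodule ℤ R) (hP : ∀ a ∈ P, δ a ∈ P)
    (l : List (PseudoDiff δ)) (hl : ∀ f ∈ l, ∀ i, f.coeff i ∈ P) (n : ℤ) :
    l.prod.coeff n ∈ P ^ l.length := by
  induction l generalizing n with
  | nil =>
    rw [List.prod_nil, coeff_one, List.length_nil, pow_zero]
    split_ifs
    · exact Submodule.one_le.mp le_rfl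
    · exact zero_mem _
  | cons f l ih =>
    rw [List.prod_cons, List.length_cons, pow_succ']
    exact coeff_mul_mem _ _ (map_mem_pow P hP _) _ _ (hl f (by simp))
      (ih fun g hg => hl g (by simp [hg])) n

variable (δ) in
/-- The two-sided ideal `P((x⁻¹; δ))` for a `δ`-stable two-sided ideal `P`. -/
noncomputable def coeffIdeal (P : TwoSidedIdeal R) (hP : ∀ a ∈ P, δ a ∈ P) : TwoSidedIdeal (PseudoDiff δ) :=
  TwoSidedIdeal.mk' (coeffsIn δ P) (fun _ => P.zero_mem)
    (fun hf hg i => P.add_mem (hf i) (hg i)) (fun hf i => P.neg_mem (hf i))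
    (fun {f g} hg n => by
      have := coeff_mul_mem ⊤ P.toIntSubmodule
        (by simpa only [TwoSidedIdeal.mem_toIntSubmodule] using hP) f g (fun _ => trivial)
        (fun i => TwoSidedIdeal.mem_toIntSubmodule.mpr (hg i)) n
      refine TwoSidedIdeal.mem_toIntSubmodule.mp ((Submodule.mul_le.mpr ?_) this)
      intro x _ y hy
      exact TwoSidedIdeal.mem_toIntSubmodule.mpr
        (P.mul_mem_left _ _ (TwoSidedIdeal.mem_toIntSubmodule.mp hy)))
    (fun {f g} hf n => by
      have := coeff_mul_mem P.toIntSubmodule ⊤ (fun _ _ => trivial) f g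
        (fun i => TwoSidedIdeal.mem_toIntSubmodule.mpr (hf i)) (fun _ => trivial) n
      refine TwoSidedIdeal.mem_toIntSubmodule.mp ((Submodule.mul_le.mpr ?_) this)
      intro x hx y _
      exact TwoSidedIdeal.mem_toIntSubmodule.mpr
        (P.mul_mem_right _ _ (TwoSidedIdeal.mem_toIntSubmodule.mp hx)))

theorem mem_coeffIdeal {P : TwoSidedIdeal R} {hP : ∀ a ∈ P, δ a ∈ P} {f : PseudoDiff δ} :
    f ∈ coeffIdeal δ P hP ↔ ∀ i, f.coeff i ∈ P :=
  TwoSidedIdeal.mem_mk' _ _ _ _ _ _ _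

theorem isLeftTNilpotent_coeffIdeal {P : TwoSidedIdeal R} (hP : ∀ a ∈ P, δ a ∈ P) (m : ℕ)
    (hm : P.toIntSubmodule ^ m = ⊥) :
    IsLeftTNilpotent (coeffIdeal δ P hP : Set (PseudoDiff δ)) := by
  refine TwoSidedIdeal.isLeftTNilpotent_of_pow_eq_bot _ m ?_
  refine TwoSidedIdeal.toIntSubmodule_pow_eq_bot _ m fun l hl hlen => ?_
  ext n
  have := coeff_list_prod_mem_pow P.toIntSubmodule
    (by simpa only [TwoSidedIdeal.mem_toIntSubmodule] using hP) l
    (fun f hf i => TwoSidedIdeal.mem_toIntSubmodule.mpr (mem_coeffIdeal.mp (hl f hf) i)) n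
  rw [hlen, hm] at this
  simpa [coeff_zero] using this

/-- Modulo a `δ`-stable ideal `P`, leading coefficients multiply. -/
theorem leadingCoeff_mul {P : TwoSidedIdeal R} (hP : ∀ a ∈ P, δ a ∈ P) {f g : PseudoDiff δ}
    {n m : ℤ} (hf : ∀ i, n < i → f.coeff i ∈ P) (hg : ∀ i, m < i → g.coeff i ∈ P) :
    (∀ i, n + m < i → (f * g).coeff i ∈ P) ∧
      (f * g).coeff (n + m) - f.coeff n * g.coeff m ∈ P := by
  classical
  have hP' : ∀ k : ℕ, ∀ a ∈ P, δ^[k] a ∈ P := fun k => by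
    induction k with
    | zero => exact fun a ha => ha
    | succ k ih => exact fun a ha => ih _ (hP a ha)
  -- A nonzero term has `i + j ≥ s ≥ n + m`, so away from `(n, m)` either `i > n` or `j > m`, and
  -- that coefficient is in `P`.
  have hterm : ∀ s i j, (n + m < s ∨ n + m = s ∧ (i, j) ≠ (n, m)) →
      monoMul δ s i j (f.coeff i) (g.coeff j) ∈ P := by
    intro s i j hs
    unfold monoMul
    split_ifs with h
    · refine P.zsmul_mem _ ?_
      rcases lt_or_ge n i with hi | hi
      · exact P.mul_mem_right _ _ (hf i hi)
      rcases lt_or_ge m j with hj | hj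
      · exact P.mul_mem_left _ _ (hP' _ _ (hg j hj))
      · exfalso
        rw [Ne, Prod.mk.injEq] at hs
        omega
    · exact P.zero_mem
  obtain ⟨N, hN⟩ := f.bdd
  obtain ⟨M, hM⟩ := g.bdd
  refine ⟨fun s hs => ?_, ?_⟩
  · rw [coeff_mul_eq_sum f g s N M hN hM _ _ subset_rfl subset_rfl]
    exact sum_mem fun i _ => sum_mem fun j _ => hterm s i j (Or.inl hs)
  -- `n` and `m` are inserted because they may exceed the degree bounds `N` and `M`; the term at
  -- `(n, m)` can then be split off.
  · rw [coeff_mul_eq_sum f g (n + m) N M hN hM (insert n (Finset.Icc (n + m - M) N))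
      (insert m (Finset.Icc (n + m - N) M)) (Finset.subset_insert _ _) (Finset.subset_insert _ _),
      ← Finset.sum_product', ← Finset.add_sum_erase _ _ (Finset.mk_mem_product
        (Finset.mem_insert_self n _) (Finset.mem_insert_self m _))]
    have h0 : monoMul δ (n + m) n m (f.coeff n) (g.coeff m) = f.coeff n * g.coeff m := by
      simp [monoMul]
    simp only [h0, add_sub_cancel_left]
    refine sum_mem fun p hp => hterm _ _ _ (Or.inr ⟨rfl, ?_⟩)
    exact (Finset.mem_erase.mp hp).1

/-- A power of `x` on the right only shifts, since `δ^k(1) = 0` for `k > 0`. -/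
theorem coeff_mul_monomial_one (f : PseudoDiff δ) (i n : ℤ) :
    (f * monomial δ i 1).coeff n = f.coeff (n - i) := by
  rw [coeff_mul, finsum_eq_single _ (n - i, 0)]
  · simp [coeff_monomial]
  · rintro ⟨j, k⟩ h
    rw [coeff_monomial]
    by_cases hk : k = 0
    · subst hk
      have hi : n - j ≠ i := fun hi => h (by rw [show j = n - i by omega])
      simp [hi]
    · split_ifs <;> simp [RingDerivation.iterate_one, hk]

theorem coeff_X_mul (f : PseudoDiff δ) (n : ℤ) :
    (monomial δ 1 1 * f).coeff n = f.coeff (n - 1) + δ (f.coeff n) := by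
  rw [coeff_mul, finsum_eq_sum_of_support_subset (s := {((1 : ℤ), 0), ((1 : ℤ), 1)})]
  · rw [Finset.sum_pair (by simp)]
    simp [coeff_monomial]
  · rintro ⟨j, k⟩ h
    by_contra hjk
    refine h ?_
    by_cases hj : j = 1
    · subst hj
      have hk : 2 ≤ k := by
        by_contra hk
        have : k = 0 ∨ k = 1 := by omega
        rcases this with rfl | rfl <;> simp at hjk
      have : Ring.choose (1 : ℤ) k = 0 := by
        have := Ring.choose_natCast (R := ℤ) 1 k
        rw [Nat.choose_eq_zero_of_lt (by omega)] at this
        simpa using this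
      simp [this]
    · simp [coeff_monomial, hj]

/-! ### Leading coefficients of a nil ideal -/

/-- `IsTop P I a`: modulo `P`, some element of `I` has degree at most `0` and constant term `a`. -/
def IsTop (P : TwoSidedIdeal R) (I : TwoSidedIdeal (PseudoDiff δ)) (a : R) : Prop :=
  ∃ f ∈ I, (∀ i, 0 < i → f.coeff i ∈ P) ∧ f.coeff 0 - a ∈ P

theorem IsTop.mul_right {P : TwoSidedIdeal R} (hP : ∀ a ∈ P, δ a ∈ P)
    {I : TwoSidedIdeal (PseudoDiff δ)} {a : R} (ha : IsTop P I a) (r : R) : IsTop P I (a * r) := by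
  obtain ⟨f, hfI, hf, hfa⟩ := ha
  obtain ⟨h1, h2⟩ := leadingCoeff_mul hP (g := monomial δ 0 r) (m := 0) hf (fun i hi => by
    rw [coeff_monomial, if_neg hi.ne']; exact P.zero_mem)
  refine ⟨f * monomial δ 0 r, I.mul_mem_right _ _ hfI, by simpa using h1, ?_⟩
  have h3 := P.add_mem h2 (P.mul_mem_right _ r hfa)
  simpa [coeff_monomial, sub_mul] using h3

/-- The commutator `x f - f x` applies `δ` to each coefficient of `f`: the shifts by one degree
cancel. It stays in `I` and does not raise the degree. -/
theorem IsTop.map {P : TwoSidedIdeal R} (hP : ∀ a ∈ P, δ a ∈ P)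
    {I : TwoSidedIdeal (PseudoDiff δ)} {a : R} (ha : IsTop P I a) : IsTop P I (δ a) := by
  obtain ⟨f, hfI, hf, hfa⟩ := ha
  have hc : ∀ i, (monomial δ 1 1 * f - f * monomial δ 1 1).coeff i = δ (f.coeff i) := fun i => by
    rw [coeff_sub, coeff_X_mul, coeff_mul_monomial_one, add_sub_cancel_left]
  refine ⟨_, I.sub_mem (I.mul_mem_left (monomial δ 1 1) _ hfI)
    (I.mul_mem_right _ (monomial δ 1 1) hfI), fun i hi => ?_, ?_⟩
  · rw [hc]; exact hP _ (hf i hi)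
  · rw [hc, ← map_sub]; exact hP _ hfa

theorem leadingCoeff_pow {P : TwoSidedIdeal R} (hP : ∀ a ∈ P, δ a ∈ P) {f : PseudoDiff δ} {a : R}
    (hf : ∀ i, 0 < i → f.coeff i ∈ P) (hfa : f.coeff 0 - a ∈ P) (k : ℕ) :
    (∀ i, 0 < i → (f ^ k).coeff i ∈ P) ∧ (f ^ k).coeff 0 - a ^ k ∈ P := by
  induction k with
  | zero =>
    refine ⟨fun i hi => ?_, ?_⟩
    · rw [pow_zero, coeff_one, if_neg hi.ne']; exact P.zero_mem
    · simp [coeff_one, P.zero_mem]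
  | succ k ih =>
    obtain ⟨h1, h2⟩ := leadingCoeff_mul hP ih.1 hf
    rw [pow_succ, pow_succ]
    refine ⟨by simpa using h1, ?_⟩
    -- With `c` the constant term of `f ^ k` and `c'` that of `f`, the telescoping is `c c' - a^k a
    -- = c (c' - a) + (c - a^k) a`.
    have h3 := P.add_mem h2 (P.add_mem (P.mul_mem_left ((f ^ k).coeff 0) _ hfa)
      (P.mul_mem_right _ a ih.2))
    rw [add_zero] at h3
    convert h3 using 1
    noncomm_ring

/-- If `f ^ k = 0` then `a ^ k ∈ P`, and `P` is nil. -/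
theorem IsTop.isNilpotent {P : TwoSidedIdeal R} (hP : ∀ a ∈ P, δ a ∈ P)
    (hnil : ∀ a ∈ P, IsNilpotent a) {I : TwoSidedIdeal (PseudoDiff δ)}
    (hI : ∀ f ∈ I, IsNilpotent f) {a : R} (ha : IsTop P I a) : IsNilpotent a := by
  obtain ⟨f, hfI, hf, hfa⟩ := ha
  obtain ⟨k, hk⟩ := hI f hfI
  have h := (leadingCoeff_pow hP hf hfa k).2
  rw [hk, coeff_zero, zero_sub] at h
  obtain ⟨m, hm⟩ := hnil _ (by simpa using P.neg_mem h)
  exact ⟨k * m, by rw [pow_mul, hm]⟩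

theorem coeff_mem_of_isTop {P : TwoSidedIdeal R} {I : TwoSidedIdeal (PseudoDiff δ)}
    (h : ∀ a, IsTop P I a → a ∈ P) {f : PseudoDiff δ} (hf : f ∈ I) (n : ℤ) : f.coeff n ∈ P := by
  obtain ⟨N, hN⟩ := f.bdd
  -- Downward induction from the degree bound `N`. Once the coefficients above `n` are in `P`,
  -- multiplying by `x^(-n)` makes the coefficient at `n` a top constant term; this is why `IsTop`
  -- is taken modulo `P`.
  suffices ∀ d : ℕ, ∀ n, N - d < n → f.coeff n ∈ P from this (N - n + 1).toNat n (by omega)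
  intro d
  induction d with
  | zero => intro n hn; rw [hN n (by simpa using hn)]; exact P.zero_mem
  | succ d ih =>
    intro n hn
    refine h _ ⟨f * monomial δ (-n) 1, I.mul_mem_right _ _ hf, fun i hi => ?_, ?_⟩
    · rw [coeff_mul_monomial_one]
      exact ih _ (by push_cast at hn; omega)
    · rw [coeff_mul_monomial_one]
      simp [P.zero_mem]

end PseudoDiff

/-! ### The differential core of `N` and the conclusion -/

/-- The largest `δ`-stable ideal inside a two-sided ideal `N`. -/
def TwoSidedIdeal.derivationCore {R : Type*} [Ring R] (δ : RingDerivation R)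
    (N : TwoSidedIdeal R) : TwoSidedIdeal R :=
  TwoSidedIdeal.mk' {a | ∀ j : ℕ, δ^[j] a ∈ N}
    (fun j => by rw [δ.iterate_zero_right]; exact N.zero_mem)
    (fun ha hb j => by rw [δ.iterate_add_right]; exact N.add_mem (ha j) (hb j))
    (fun {a} ha j => by rw [iterate_map_neg]; exact N.neg_mem (ha j))
    (fun hb j => by
      rw [δ.iterate_mul]
      exact sum_mem fun p _ => N.nsmul_mem _ (N.mul_mem_left _ _ (hb _)))
    (fun ha j => by
      rw [δ.iterate_mul]
      exact sum_mem fun p _ => N.nsmul_mem _ (N.mul_mem_right _ _ (ha _)))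

theorem TwoSidedIdeal.mem_derivationCore {R : Type*} [Ring R] {δ : RingDerivation R}
    {N : TwoSidedIdeal R} {a : R} : a ∈ N.derivationCore δ ↔ ∀ j : ℕ, δ^[j] a ∈ N :=
  TwoSidedIdeal.mem_mk' _ _ _ _ _ _ _

theorem TwoSidedIdeal.map_mem_derivationCore {R : Type*} [Ring R] {δ : RingDerivation R}
    {N : TwoSidedIdeal R} : ∀ a ∈ N.derivationCore δ, δ a ∈ N.derivationCore δ := by
  intro a ha
  rw [mem_derivationCore] at ha ⊢
  exact fun j => ha (j + 1)

/-- T-nilpotency makes each right ideal `δ^j(a)R` nil, so `δ^j(a) ∈ N`. Conversely, if all `δ^j(a)`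
lie in `N`, so does the right ideal they generate. -/
theorem leftTNilpotentDeltaSet_eq {R : Type*} [Ring R] (δ : RingDerivation R)
    (N : TwoSidedIdeal R) (hN : IsLeftTNilpotent (N : Set R))
    (hmem : ∀ a, (∀ r, IsNilpotent (a * r)) → a ∈ N) :
    leftTNilpotentDeltaSet δ = N.derivationCore δ := by
  ext a
  rw [SetLike.mem_coe, TwoSidedIdeal.mem_derivationCore]
  constructor
  · intro ha j
    refine hmem _ fun r => IsLeftTNilpotent.isNilpotent ha ?_
    exact Submodule.smul_mem _ (MulOpposite.op r)
      (Submodule.mem_iSup_of_mem j (Submodule.mem_span_singleton_self _))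
  · intro ha
    let N' : Submodule Rᵐᵒᵖ R :=
      { carrier := N
        zero_mem' := N.zero_mem
        add_mem' := fun hx hy => N.add_mem hx hy
        smul_mem' := fun r x hx => N.mul_mem_right _ _ hx }
    have hle : (⨆ j : ℕ, Submodule.span Rᵐᵒᵖ {δ^[j] a}) ≤ N' :=
      iSup_le fun j => (Submodule.span_singleton_le_iff_mem _ _).mpr (ha j)
    exact hN.mono hle

/-- Left Noetherian is `IsNoetherianRing R`; right Noetherian is `IsNoetherian Rᵐᵒᵖ R`. -/
theorem theorem2p9 {R : Type*} [Ring R] (δ : RingDerivation R)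
    (hR : IsNoetherianRing R ∨ IsNoetherian Rᵐᵒᵖ R) :
    (leftTNilpotentRadideal (PseudoDiff δ) : Set (PseudoDiff δ)) =
      PseudoDiff.coeffsIn δ (leftTNilpotentDeltaSet δ) := by
  obtain ⟨N, ⟨m, hm⟩, hN⟩ := exists_nilpotent_twoSidedIdeal hR
  have hNT := N.isLeftTNilpotent_of_pow_eq_bot m hm
  rw [leftTNilpotentDeltaSet_eq δ N hNT hN]
  have hP := TwoSidedIdeal.map_mem_derivationCore (δ := δ) (N := N)
  have hPN : N.derivationCore δ ≤ N := fun a ha => TwoSidedIdeal.mem_derivationCore.mp ha 0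
  have hPm : (N.derivationCore δ).toIntSubmodule ^ m = ⊥ := by
    rw [eq_bot_iff, ← hm]
    exact pow_le_pow_left' (fun x hx => TwoSidedIdeal.mem_toIntSubmodule.mpr
      (hPN (TwoSidedIdeal.mem_toIntSubmodule.mp hx))) m
  have hK := PseudoDiff.isLeftTNilpotent_coeffIdeal hP m hPm
  refine Set.Subset.antisymm ?_ ?_
  · have : leftTNilpotentRadideal (PseudoDiff δ) ≤ PseudoDiff.coeffIdeal δ _ hP := by
      -- It is enough to bound each left T-nilpotent ideal separately; the sum itself need not be
      -- known to be T-nilpotent.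
      refine sSup_le fun I hI => ?_
      intro f hf
      rw [PseudoDiff.mem_coeffIdeal]
      refine PseudoDiff.coeff_mem_of_isTop (I := I) (fun a ha => ?_) hf
      rw [TwoSidedIdeal.mem_derivationCore]
      intro j
      -- Top constant terms are stable under `δ` and right multiplication and are nilpotent, so
      -- every `δ^j(a)R` is nil.
      have haj : PseudoDiff.IsTop (N.derivationCore δ) I (δ^[j] a) := by
        induction j with
        | zero => exact ha
        | succ j ih => rw [Function.iterate_succ_apply']; exact ih.map hP
      exact hN _ fun r => (haj.mul_right hP r).isNilpotent hP
        (fun b hb => hNT.isNilpotent (hPN hb)) (fun g hg => IsLeftTNilpotent.isNilpotent hI hg)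
    exact fun f hf => PseudoDiff.mem_coeffIdeal.mp (this hf)
  · intro f hf
    exact (le_sSup hK : PseudoDiff.coeffIdeal δ _ hP ≤ leftTNilpotentRadideal (PseudoDiff δ))
      (PseudoDiff.mem_coeffIdeal.mpr hf)
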